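/- Let $K$ be an infinite field, let $n\ge 0$ and $m\ge 1$ be integers, and let $S=K[x_1,\dots,x_n,y_1,\dots,y_m]$ be bigraded by $\deg x_i=(1,0)$ and $\deg y_j=(0,1)$; for a bihomogeneous element $w$ of bidegree $(a,b)$ write $\deg_x w=a$ and $\deg_y w=b$. Let $S_x=K[x_1,\dots,x_n]$ with its standard grading. For a finitely generated $\mathbb Z$-graded $S_x$-module $N$ put $$\operatorname{reg}^{S_x}(N)=\sup\{a\in\mathbb Z:\ \operatorname{Tor}_i^{S_x}(K,N)_{a+i}\neq 0\text{ for some } i\ge 0\}\in\mathbb Z\cup\{\pm\infty\}.$$ Let $t\ge 0$ and let $z_1,\dots,z_t\in S$ be a regular sequence of bihomogeneous elements which is a minimal system of generators of the ideal $J=(z_1,\dots,z_t)$, and assume that $$0<\deg_x(z_1)\le\dots\le\deg_x(z_t),\qquad \deg_y(z_k)=1\ \text{ for } k=1,\dots,t.$$ Let $R=S/J$ with the induced bigrading, and for $j\ge 0$ regard $R_{(*,j)}=\bigoplus_{a}R_{(a,j)}$ as a graded $S_x$-module. Then $$\operatorname{reg}^{S_x}(R_{(*,j+1)})=\operatorname{reg}^{S_x}(R_{(*,j)})\qquad\text{for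 all } j\ge t.$$ If in addition $\deg_x(z_k)=1$ for $k=1,\dots,t$, then $$\operatorname{reg}^{S_x}(R_{(*,j)})=0\qquad\text{for all } j\ge 1.$$ -/

import Mathlib

open MvPolynomial

noncomputable section

/-! ### Graded modules over a standard graded polynomial ring: resolutions, Tor, regularity -/

section Regularity

variable (n : ℕ) {K : Type*} [Field K] {M : Type*} [AddCommGroup M]
  [Module (MvPolynomial (Fin n) K) M] [Module K M]

/-- A graded free resolution `⋯ → F₂ → F₁ → F₀ → M → 0`, by finitely generated graded free modules,
of a `ℤ`-graded module `M = ⨁ₐ 𝓜 a` over the standard graded polynomial ring `A = K[x₁,…,xₙ]`.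
Here `Fᵢ = ⨁_{b ∈ ι i} A(-deg i b)`, the differentials are given by matrices, and all maps are
homogeneous of degree `0`. -/
structure GradedFreeResolution (𝓜 : ℤ → Submodule K M) where
  /-- index set of the chosen homogeneous basis of `Fᵢ` -/
  ι : ℕ → Type
  finite : ∀ i, Fintype (ι i)
  /-- degrees of the basis elements of `Fᵢ` -/
  deg : ∀ i, ι i → ℤ
  /-- matrix of the differential `Fᵢ₊₁ → Fᵢ` -/
  d : ∀ i, Matrix (ι i) (ι (i + 1)) (MvPolynomial (Fin n) K)
  /-- the augmentation `F₀ → M` -/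
  ε : (ι 0 → MvPolynomial (Fin n) K) →ₗ[MvPolynomial (Fin n) K] M
  homogeneous_d : ∀ i c b,
    IsWeightedHomogeneous (fun _ : Fin n => (1 : ℤ)) (d i c b) (deg (i + 1) b - deg i c)
  homogeneous_ε : ∀ b, letI := Classical.decEq (ι 0); ε (Pi.single b 1) ∈ 𝓜 (deg 0 b)
  surjective_ε : Function.Surjective ε
  exact_zero : letI := finite 1; Function.Exact (d 0).mulVecLin ε
  exact_succ : ∀ i, letI := finite (i + 1); letI := finite (i + 2)
    Function.Exact (d (i + 1)).mulVecLin (d i).mulVecLin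

namespace GradedFreeResolution

variable {n} {𝓜 : ℤ → Submodule K M} (F : GradedFreeResolution n 𝓜)

/-- The component of degree `a` of `K ⊗_A Fᵢ`, where `K = A / (x₁,…,xₙ)`: the vector space on the
basis elements of `Fᵢ` of degree `a`. -/
abbrev TensorComponent (i : ℕ) (a : ℤ) : Type _ := {b : F.ι i // F.deg i b = a} → K

/-- The component of degree `a` of the differential `K ⊗_A Fᵢ₊₁ → K ⊗_A Fᵢ`: the entries of the
matrix are reduced modulo `(x₁,…,xₙ)`. -/
def tensorD (i : ℕ) (a : ℤ) : F.TensorComponent (i + 1) a →ₗ[K] F.TensorComponent i a :=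
  letI := F.finite (i + 1)
  letI : Fintype {b : F.ι (i + 1) // F.deg (i + 1) b = a} := Fintype.ofFinite _
  (((F.d i).map constantCoeff).submatrix Subtype.val Subtype.val).mulVecLin

/-- Cycles of `K ⊗_A F` in homological degree `i` and internal degree `a`. -/
def cycles : ∀ (i : ℕ) (a : ℤ), Submodule K (F.TensorComponent i a)
  | 0, _ => ⊤
  | i + 1, a => LinearMap.ker (F.tensorD i a)

/-- Boundaries of `K ⊗_A F` in homological degree `i` and internal degree `a`. -/
def boundaries (i : ℕ) (a : ℤ) : Submodule K (F.TensorComponent i a) :=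
  LinearMap.range (F.tensorD i a)

/-- `Tor_i^A(K, M)_a`, computed as `H_i(K ⊗_A F)_a`. -/
abbrev Tor (i : ℕ) (a : ℤ) : Type _ :=
  F.cycles i a ⧸ (F.boundaries i a).submoduleOf (F.cycles i a)

end GradedFreeResolution

open Classical in
/-- The graded Betti number `β_{i,a}(M) = dim_K Tor_i^A(K, M)_a` of a finitely generated graded
module `M = ⨁ₐ 𝓜 a` over `A = K[x₁,…,xₙ]`. The Tor module is computed from some graded free
resolution of `M`; such a resolution exists, and the dimension does not depend on it. -/
def gradedBetti (𝓜 : ℤ → Submodule K M) (i : ℕ) (a : ℤ) : ℕ :=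
  if h : Nonempty (GradedFreeResolution n 𝓜) then Module.finrank K (h.some.Tor i a) else 0

/-- The Castelnuovo–Mumford regularity `sup {a ∈ ℤ : β_{i,a+i}(M) ≠ 0 for some i}` of a finitely
generated graded module over `K[x₁,…,xₙ]`, as an extended integer (`⊥ = -∞` for the zero module). -/
def gradedReg (𝓜 : ℤ → Submodule K M) : WithBot (WithTop ℤ) :=
  sSup {r | ∃ a : ℤ, (∃ i : ℕ, gradedBetti n 𝓜 i (a + i) ≠ 0) ∧ r = ((a : WithTop ℤ) : WithBot _)}

end Regularity

/-! ### The bigraded polynomial ring and its bigraded quotients -/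

section Bigraded

variable (n m : ℕ) (K : Type*) [Field K]

/-- `S = K[x₁,…,xₙ,y₁,…,yₘ]`. -/
abbrev BiPoly : Type _ := MvPolynomial (Fin n ⊕ Fin m) K

/-- The standard bigrading: `deg xᵢ = (1,0)`, `deg yⱼ = (0,1)`. -/
def bideg : Fin n ⊕ Fin m → ℤ × ℤ := Sum.elim (fun _ => (1, 0)) (fun _ => (0, 1))

/-- `S` as an algebra over `S_x = K[x₁,…,xₙ]`, by the inclusion of the `x`-variables. -/
instance biPolyAlgebra : Algebra (MvPolynomial (Fin n) K) (BiPoly n m K) :=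
  (rename Sum.inl : MvPolynomial (Fin n) K →ₐ[K] BiPoly n m K).toRingHom.toAlgebra

instance biPolyScalarTower : IsScalarTower K (MvPolynomial (Fin n) K) (BiPoly n m K) :=
  IsScalarTower.of_algebraMap_eq fun r =>
    ((rename Sum.inl : MvPolynomial (Fin n) K →ₐ[K] BiPoly n m K).commutes r).symm

variable {n m K}

/-- The bigraded component `R_{(a,b)}` of `R = S/J`: the image of `S_{(a,b)}`. -/
def biComponent (J : Ideal (BiPoly n m K)) (a b : ℤ) : Submodule K (BiPoly n m K ⧸ J) :=
  (weightedHomogeneousSubmodule K (bideg n m) (a, b)).map (Ideal.Quotient.mkₐ K J).toLinearMap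

lemma smul_mem_iSup_biComponent (J : Ideal (BiPoly n m K)) (b : ℤ) (p : MvPolynomial (Fin n) K)
    {w : BiPoly n m K ⧸ J} (hw : w ∈ ⨆ a : ℤ, biComponent J a b) :
    p • w ∈ ⨆ a : ℤ, biComponent J a b := by
  induction p using MvPolynomial.induction_on generalizing w with
  | C r =>
    have : (C r : MvPolynomial (Fin n) K) • w = r • w := by
      rw [← MvPolynomial.algebraMap_eq, algebraMap_smul]
    rw [this]
    exact Submodule.smul_mem _ _ hw
  | add p q hp hq => rw [add_smul]; exact add_mem (hp hw) (hq hw)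
  | mul_X p i hp =>
    rw [mul_smul]
    refine hp ?_
    induction hw using Submodule.iSup_induction' with
    | mem a w hw =>
      obtain ⟨f, hf, rfl⟩ := hw
      refine Submodule.mem_iSup_of_mem (1 + a) ⟨X (Sum.inl i) * f, ?_, ?_⟩
      · have h := (isWeightedHomogeneous_X K (bideg n m) (Sum.inl i)).mul hf
        simpa [bideg] using h
      · have h : (X i : MvPolynomial (Fin n) K) • f = X (Sum.inl i) * f := by
          rw [Algebra.smul_def]
          congr 1
          exact rename_X _ _
        rw [← h]
        rfl
    | zero => simp
    | add u v _ _ hu hv => rw [smul_add]; exact add_mem hu hv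

/-- The `S_x`-module `R_{(*,b)} = ⨁ₐ R_{(a,b)}` for `R = S/J`. -/
def rowModule (J : Ideal (BiPoly n m K)) (b : ℤ) :
    Submodule (MvPolynomial (Fin n) K) (BiPoly n m K ⧸ J) where
  carrier := {w | w ∈ ⨆ a : ℤ, biComponent J a b}
  add_mem' := (⨆ a : ℤ, biComponent J a b).add_mem
  zero_mem' := zero_mem (⨆ a : ℤ, biComponent J a b)
  smul_mem' p _ hw := smul_mem_iSup_biComponent J b p hw

/-- The `x`-grading of `R_{(*,b)}`: its component of degree `a` is `R_{(a,b)}`. -/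
def rowGrading (J : Ideal (BiPoly n m K)) (b a : ℤ) : Submodule K (rowModule J b) :=
  (biComponent J a b).comap ((rowModule J b).subtype.restrictScalars K)

end Bigraded

end

/-! View `S` as `K[x][y]`. Since the `z k` form a regular sequence, their Koszul complex resolves `R
= S/J`. Each `z k` is linear in `y`, so in `y`-degree `j` the complex becomes a resolution of
`R_{(*,j)}` by finitely generated graded free `K[x]`-modules. A basis of its `i`-th term consists of
pairs of an `i`-subset of the `z k` and a monomial in `y` of degree `j - i`; the degree of such a
pair is the sum of the `x`-degrees over the subset.

The matrix entries are, up to sign, zero or coefficients in `K[x]` of the `z k`. They have positive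
degree, so the resolution is minimal and its Betti numbers are read off from its basis. As `m ≥ 1`,
there is a monomial of degree `j - i` exactly when `i ≤ j`. Hence `j` matters only through the
condition `i ≤ j`, which is vacuous for `j ≥ t` because the complex has length `t`. If all
`x`-degrees are `1`, the `i`-th term is generated in degree `i`, and the regularity is `0`.

`koszulMatrix_exact`, `exists_strandMatrix_mulVec_iff` and `gradedBetti_ne_zero_iff_of_minimal`
carry the argument. Because `gradedBetti` uses a chosen resolution,
`cycles_le_boundaries_of_comparison` is needed to show that vanishing of Tor can be tested on any
other one. -/

noncomputable section

/-! ### Homogeneous matrices over `K[x]` and their reduction modulo the variables -/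

section Components

variable {σ R M : Type*} [CommSemiring R] [AddCancelCommMonoid M] [DecidableEq M]

lemma weightedHomogeneousComponent_mul_of_left {w : σ → M} {k : M} {p : MvPolynomial σ R}
    (hp : IsWeightedHomogeneous w p k) (l : M) (q : MvPolynomial σ R) :
    weightedHomogeneousComponent w (k + l) (p * q) = p * weightedHomogeneousComponent w l q := by
  let _ := weightedGradedAlgebra R w
  have h := DirectSum.coe_decompose_mul_add_of_left_mem (weightedHomogeneousSubmodule R w)
    (i := k) (j := l) (a := p) (b := q) hp
  have h' := fun (f : MvPolynomial σ R) (m : M) => weightedDecomposition.decompose'_apply R w f m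
  rw [← h', ← h']
  exact h

end Components

section GradedMatrix

variable {n : ℕ} {K : Type*} [Field K] {κ μ ν : Type*}

/-- A matrix of a homogeneous map of degree `0` between graded free modules with generators in
degrees `q` and `p`. -/
def IsGradedMatrix (p : κ → ℤ) (q : μ → ℤ) (U : Matrix κ μ (MvPolynomial (Fin n) K)) : Prop :=
  ∀ c b, IsWeightedHomogeneous (fun _ : Fin n => (1 : ℤ)) (U c b) (q b - p c)

/-- Taking from each entry of `W` the component of the degree prescribed by the gradings does not
change the product, since `D` is homogeneous and `U` already lies in the expected degrees. -/
lemma IsGradedMatrix.exists_of_mul_eq [Fintype μ] {p : κ → ℤ} {q : μ → ℤ} {r : ν → ℤ}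
    {D : Matrix κ μ (MvPolynomial (Fin n) K)} {U : Matrix κ ν (MvPolynomial (Fin n) K)}
    (hD : IsGradedMatrix p q D) (hU : IsGradedMatrix p r U) {W : Matrix μ ν (MvPolynomial (Fin n) K)}
    (hW : D * W = U) : ∃ V : Matrix μ ν (MvPolynomial (Fin n) K), IsGradedMatrix q r V ∧ D * V = U := by
  refine ⟨Matrix.of fun b e =>
      weightedHomogeneousComponent (fun _ => (1 : ℤ)) (r e - q b) (W b e),
    fun b e => weightedHomogeneousComponent_isWeightedHomogeneous (w := fun _ => (1 : ℤ))
      (r e - q b) (W b e), ?_⟩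
  ext1 c e
  rw [← (hU c e).weightedHomogeneousComponent_same, ← hW, Matrix.mul_apply, Matrix.mul_apply,
    map_sum]
  refine Finset.sum_congr rfl fun b _ => ?_
  rw [Matrix.of_apply, ← weightedHomogeneousComponent_mul_of_left (hD c b), add_comm, sub_add_sub_cancel]

lemma IsGradedMatrix.mul [Fintype μ] {p : κ → ℤ} {q : μ → ℤ} {r : ν → ℤ}
    {U : Matrix κ μ (MvPolynomial (Fin n) K)} {V : Matrix μ ν (MvPolynomial (Fin n) K)}
    (hU : IsGradedMatrix p q U) (hV : IsGradedMatrix q r V) : IsGradedMatrix p r (U * V) := by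
  intro c e
  rw [Matrix.mul_apply]
  refine IsWeightedHomogeneous.sum _ _ _ fun b _ => ?_
  have := (hU c b).mul (hV b e)
  rwa [add_comm, sub_add_sub_cancel] at this

/-- The degree `a` part of a matrix reduced modulo the variables. -/
def reduceAt (p : κ → ℤ) (q : μ → ℤ) (a : ℤ) (U : Matrix κ μ (MvPolynomial (Fin n) K)) :
    Matrix {c // p c = a} {b // q b = a} K :=
  (U.map constantCoeff).submatrix Subtype.val Subtype.val

lemma reduceAt_apply (p : κ → ℤ) (q : μ → ℤ) (a : ℤ) (U : Matrix κ μ (MvPolynomial (Fin n) K))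
    (c : {c // p c = a}) (b : {b // q b = a}) : reduceAt p q a U c b = constantCoeff (U c b) := rfl

lemma _root_.MvPolynomial.IsWeightedHomogeneous.constantCoeff_eq_zero {σ R M : Type*} [CommSemiring R]
    [AddCommMonoid M] {w : σ → M} {p : MvPolynomial σ R} {k : M}
    (hp : IsWeightedHomogeneous w p k) (hk : k ≠ 0) : constantCoeff p = 0 := by
  rw [constantCoeff_eq]
  by_contra h
  exact hk (by simpa using (hp h).symm)

lemma sum_subtype_degree {β : Type*} [AddCommMonoid β] [Fintype μ] {q : μ → ℤ} {a : ℤ}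
    [Fintype {b // q b = a}] {f : μ → β} (hf : ∀ b, q b ≠ a → f b = 0) :
    ∑ b, f b = ∑ b : {b // q b = a}, f b := by
  classical
  rw [← Finset.sum_filter_of_ne (p := fun b => q b = a) (fun b _ h => by
    by_contra h'; exact h (hf b h')), ← Finset.sum_subtype_eq_sum_filter]
  refine Finset.sum_bij (fun x _ => x) ?_ ?_ ?_ ?_ <;> simp

/-- A homogeneous entry between generators of different degrees has no constant term, so only middle
indices of degree `a` contribute. Homogeneity of one factor is enough. -/
lemma reduceAt_mul_of_left [Fintype μ] {p : κ → ℤ} {q : μ → ℤ} {r : ν → ℤ} {a : ℤ}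
    [Fintype {b // q b = a}]
    {U : Matrix κ μ (MvPolynomial (Fin n) K)} {V : Matrix μ ν (MvPolynomial (Fin n) K)}
    (hU : IsGradedMatrix p q U) :
    reduceAt p r a (U * V) = reduceAt p q a U * reduceAt q r a V := by
  ext ⟨c, hc⟩ ⟨e, he⟩
  simp only [reduceAt, Matrix.submatrix_apply, Matrix.map_apply, Matrix.mul_apply, map_sum, map_mul]
  refine sum_subtype_degree fun b hb => ?_
  rw [(hU c b).constantCoeff_eq_zero (by rw [hc]; exact sub_ne_zero.2 hb), zero_mul]

lemma reduceAt_mul_of_right [Fintype μ] {p : κ → ℤ} {q : μ → ℤ} {r : ν → ℤ} {a : ℤ}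
    [Fintype {b // q b = a}]
    {U : Matrix κ μ (MvPolynomial (Fin n) K)} {V : Matrix μ ν (MvPolynomial (Fin n) K)}
    (hV : IsGradedMatrix q r V) :
    reduceAt p r a (U * V) = reduceAt p q a U * reduceAt q r a V := by
  ext ⟨c, hc⟩ ⟨e, he⟩
  simp only [reduceAt, Matrix.submatrix_apply, Matrix.map_apply, Matrix.mul_apply, map_sum, map_mul]
  refine sum_subtype_degree fun b hb => ?_
  rw [(hV b e).constantCoeff_eq_zero (by rw [he]; exact sub_ne_zero.2 (Ne.symm hb)), mul_zero]

end GradedMatrix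

/-! ### Comparison of resolutions: vanishing of Tor does not depend on the choice -/

section Comparison

lemma exists_seq_of_step {α : ℕ → Type*} (P : ∀ i, α i → Prop) (r : ∀ i, α i → α (i + 1) → Prop)
    {x : α 0} (hx : P 0 x) (step : ∀ i x, P i x → ∃ y, P (i + 1) y ∧ r i x y) :
    ∃ s : ∀ i, α i, s 0 = x ∧ (∀ i, P i (s i)) ∧ ∀ i, r i (s i) (s (i + 1)) := by
  choose f hf using step
  let s : ∀ i, {x : α i // P i x} := fun i =>
    Nat.rec ⟨x, hx⟩ (fun i y => ⟨f i y.1 y.2, (hf i y.1 y.2).1⟩) i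
  exact ⟨fun i => (s i).1, rfl, fun i => (s i).2, fun i => (hf i (s i).1 (s i).2).2⟩

variable {n : ℕ} {K : Type*} [Field K] {M : Type*} [AddCommGroup M]
  [Module (MvPolynomial (Fin n) K) M] [Module K M] {𝓜 : ℤ → Submodule K M}

namespace GradedFreeResolution

instance (F : GradedFreeResolution n 𝓜) (i : ℕ) : Fintype (F.ι i) := F.finite i

lemma exists_mul_eq {κ μ ν R : Type*} [Fintype μ] [CommRing R]
    {D : Matrix κ μ R} {U : Matrix κ ν R} (h : ∀ e, ∃ w, D.mulVec w = U.col e) :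
    ∃ W : Matrix μ ν R, D * W = U := by
  choose w hw using h
  refine ⟨fun b e => w e b, ?_⟩
  ext c e
  exact congrFun (hw e) c

variable (F G : GradedFreeResolution n 𝓜)

lemma d_mul_d (i : ℕ) : F.d i * F.d (i + 1) = 0 := by
  classical
  ext1 c e
  have h := (F.exact_succ i).apply_apply_eq_zero (Pi.single e 1)
  rw [Matrix.mulVecLin_apply, Matrix.mulVecLin_apply, Matrix.mulVec_mulVec,
    Matrix.mulVec_single_one] at h
  exact congrFun h c

lemma exists_d_mul_eq {ν : Type*} {i : ℕ} {U : Matrix (F.ι (i + 1)) ν (MvPolynomial (Fin n) K)}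
    (h : F.d i * U = 0) : ∃ W : Matrix (F.ι (i + 2)) ν (MvPolynomial (Fin n) K), F.d (i + 1) * W = U := by
  refine exists_mul_eq fun e => (F.exact_succ i (U.col e)).1 ?_
  ext1 c
  exact congrFun (congrFun h c) e

lemma exists_d_zero_mul_eq {ν : Type*} {U : Matrix (F.ι 0) ν (MvPolynomial (Fin n) K)}
    (h : ∀ e, F.ε (U.col e) = 0) :
    ∃ W : Matrix (F.ι 1) ν (MvPolynomial (Fin n) K), F.d 0 * W = U :=
  exists_mul_eq fun e => (F.exact_zero (U.col e)).1 (h e)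

lemma ε_col_d_zero (e : F.ι 1) : F.ε ((F.d 0).col e) = 0 := by
  classical
  have h := F.exact_zero.apply_apply_eq_zero (Pi.single e 1)
  rwa [Matrix.mulVecLin_apply, Matrix.mulVec_single_one] at h

lemma ε_eq_sum [DecidableEq (F.ι 0)] (v : F.ι 0 → MvPolynomial (Fin n) K) :
    F.ε v = ∑ b, v b • F.ε (Pi.single b 1) := by
  conv_lhs => rw [pi_eq_sum_univ' v, map_sum]
  refine Finset.sum_congr rfl fun b _ => ?_
  rw [map_smul]

/-- The module structure respects the grading. -/
def SMulMem (n : ℕ) {K : Type*} [Field K] {M : Type*} [AddCommGroup M]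
    [Module (MvPolynomial (Fin n) K) M] [Module K M] (𝓜 : ℤ → Submodule K M) : Prop :=
  ∀ (p : MvPolynomial (Fin n) K) (k a : ℤ),
    IsWeightedHomogeneous (fun _ : Fin n => (1 : ℤ)) p k → ∀ x ∈ 𝓜 a, p • x ∈ 𝓜 (k + a)

/-- The sum of the terms with `d ≠ e` lies both in `N e` and in the span of the other pieces, hence
vanishes. -/
lemma _root_.iSupIndep.eq_of_sum_mem {N : ℤ → Submodule K M} (h : iSupIndep N) {s : Finset ℤ}
    {u : ℤ → M} (hu : ∀ d, u d ∈ N d) (hs : ∀ d ∉ s, u d = 0) {e : ℤ}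
    (he : ∑ d ∈ s, u d ∈ N e) : u e = ∑ d ∈ s, u d := by
  have h1 : ∑ d ∈ s, u d = u e + ∑ d ∈ s.erase e, u d := by
    by_cases hes : e ∈ s
    · rw [Finset.add_sum_erase _ _ hes]
    · rw [hs e hes, zero_add, Finset.erase_eq_of_notMem hes]
  have h2 : ∑ d ∈ s.erase e, u d ∈ N e := by
    have := (N e).sub_mem he (hu e)
    rwa [h1, add_sub_cancel_left] at this
  have h3 : ∑ d ∈ s.erase e, u d ∈ ⨆ d, ⨆ (_ : d ≠ e), N d :=
    Submodule.sum_mem _ fun d hd => Submodule.mem_iSup_of_mem d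
      (Submodule.mem_iSup_of_mem (Finset.ne_of_mem_erase hd) (hu d))
  rw [h1, Submodule.disjoint_def.1 (h e) _ h2 h3, add_zero]

/-- Split an arbitrary preimage into homogeneous pieces of `F₀`. Their images lie in distinct `𝓜 d`
and add up to `x ∈ 𝓜 e`, so by independence the piece of degree `e` alone maps to `x`. -/
lemma exists_homogeneous_lift (hind : iSupIndep 𝓜) (hsmul : SMulMem n 𝓜) {e : ℤ} {x : M}
    (hx : x ∈ 𝓜 e) : ∃ v : F.ι 0 → MvPolynomial (Fin n) K, F.ε v = x ∧
      ∀ b, IsWeightedHomogeneous (fun _ : Fin n => (1 : ℤ)) (v b) (e - F.deg 0 b) := by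
  classical
  obtain ⟨v, rfl⟩ := F.surjective_ε x
  let c : ℤ → F.ι 0 → MvPolynomial (Fin n) K := fun d b =>
    weightedHomogeneousComponent (fun _ => (1 : ℤ)) (d - F.deg 0 b) (v b)
  have hfin : ∀ b, {d : ℤ | c d b ≠ 0}.Finite := fun b => by
    have h := weightedHomogeneousComponent_finsupp (w := fun _ : Fin n => (1 : ℤ)) (v b)
    refine (h.image (· + F.deg 0 b)).subset fun d hd => ⟨d - F.deg 0 b, hd, by simp⟩
  let s : Finset ℤ := Finset.univ.biUnion fun b => (hfin b).toFinset
  have hcs : ∀ d ∉ s, ∀ b, c d b = 0 := fun d hd b => by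
    by_contra h
    exact hd (Finset.mem_biUnion.2 ⟨b, Finset.mem_univ _, by simpa using h⟩)
  have hsum : ∑ d ∈ s, c d = v := by
    ext1 b
    rw [Finset.sum_apply]
    conv_rhs => rw [← sum_weightedHomogeneousComponent (fun _ : Fin n => (1 : ℤ)) (v b)]
    -- Reindexes the components of `v b` by degree in `F₀`, which is polynomial degree shifted by
    -- the degree of the generator.
    rw [← finsum_comp_equiv (Equiv.subRight (F.deg 0 b))]
    refine (finsum_eq_sum_of_support_subset _ fun d hd => ?_).symm
    by_contra h
    exact hd (hcs d h b)
  have hmem : ∀ d, F.ε (c d) ∈ 𝓜 d := fun d => by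
    rw [F.ε_eq_sum]
    refine Submodule.sum_mem _ fun b _ => ?_
    have h := hsmul (c d b) (d - F.deg 0 b) (F.deg 0 b)
      (weightedHomogeneousComponent_isWeightedHomogeneous (w := fun _ => (1 : ℤ)) _ _) _ (F.homogeneous_ε b)
    rw [sub_add_cancel] at h
    convert h
  refine ⟨c e, ?_, fun b => weightedHomogeneousComponent_isWeightedHomogeneous (w := fun _ => (1 : ℤ)) _ _⟩
  rw [← hsum, map_sum] at hx ⊢
  refine hind.eq_of_sum_mem hmem (fun d hd => ?_) hx
  rw [show c d = 0 from funext (hcs d hd), map_zero]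

/-- Lifting the identity of `M` through the free modules one step at a time. The recursion carries,
besides homogeneity, the solvability of the next square, so that its first step can use exactness at
`F₀` and the later ones exactness further left. -/
lemma exists_chainMap (hind : iSupIndep 𝓜) (hsmul : SMulMem n 𝓜) :
    ∃ u : ∀ i, Matrix (G.ι i) (F.ι i) (MvPolynomial (Fin n) K),
      (∀ i, IsGradedMatrix (G.deg i) (F.deg i) (u i)) ∧
      (∀ i, G.d i * u (i + 1) = u i * F.d i) ∧
      ∀ v, G.ε ((u 0).mulVec v) = F.ε v := by
  classical
  have h0 : ∃ U : Matrix (G.ι 0) (F.ι 0) (MvPolynomial (Fin n) K),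
      IsGradedMatrix (G.deg 0) (F.deg 0) U ∧ ∀ v, G.ε (U.mulVec v) = F.ε v := by
    have h : ∀ b : F.ι 0, F.ε (Pi.single b 1) ∈ 𝓜 (F.deg 0 b) := fun b => by
      convert F.homogeneous_ε b
    choose w hw using fun b => G.exists_homogeneous_lift hind hsmul (h b)
    refine ⟨fun c b => w b c, fun c b => (hw b).2 c, fun v => ?_⟩
    rw [F.ε_eq_sum]
    simp_rw [← (hw _).1, ← map_smul, ← map_sum]
    congr 1
    ext1 c
    simp [Matrix.mulVec, dotProduct, mul_comm]
  obtain ⟨U, hU, hUε⟩ := h0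
  obtain ⟨u, h0, hu, hr⟩ := exists_seq_of_step
    (fun i (V : Matrix (G.ι i) (F.ι i) (MvPolynomial (Fin n) K)) =>
      IsGradedMatrix (G.deg i) (F.deg i) V ∧
        ∃ W : Matrix (G.ι (i + 1)) (F.ι (i + 1)) (MvPolynomial (Fin n) K),
          G.d i * W = V * F.d i)
    (fun i V W => G.d i * W = V * F.d i)
    ⟨hU, G.exists_d_zero_mul_eq fun e => by rw [← F.ε_col_d_zero e, ← hUε]; rfl⟩
    (by
      rintro i V ⟨hV, W, hW⟩
      obtain ⟨W', hW', hWd⟩ := IsGradedMatrix.exists_of_mul_eq (G.homogeneous_d i)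
        (hV.mul (F.homogeneous_d i)) hW
      refine ⟨W', ⟨hW', G.exists_d_mul_eq ?_⟩, hWd⟩
      rw [← Matrix.mul_assoc, hWd, Matrix.mul_assoc, F.d_mul_d, Matrix.mul_zero])
  exact ⟨u, fun i => (hu i).1, hr, by rwa [h0]⟩

/-- A chain endomorphism inducing zero on `M` is null-homotopic. The homotopy need not be
homogeneous: reduction in a fixed degree is multiplicative as soon as the differential is. -/
lemma exists_homotopy {e : ∀ i, Matrix (G.ι i) (G.ι i) (MvPolynomial (Fin n) K)}
    (he : ∀ i, G.d i * e (i + 1) = e i * G.d i) (h0 : ∀ b, G.ε ((e 0).col b) = 0) :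
    ∃ h : ∀ i, Matrix (G.ι (i + 1)) (G.ι i) (MvPolynomial (Fin n) K),
      e 0 = G.d 0 * h 0 ∧ ∀ i, e (i + 1) = G.d (i + 1) * h (i + 1) + h i * G.d i := by
  obtain ⟨W, hW⟩ := G.exists_d_zero_mul_eq h0
  obtain ⟨h, hW', -, hr⟩ := exists_seq_of_step
    (fun i (V : Matrix (G.ι (i + 1)) (G.ι i) (MvPolynomial (Fin n) K)) =>
      -- The part of `e (i + 1)` not yet explained by `V` is a cycle, so exactness gives the next
      -- homotopy matrix.
      G.d i * (e (i + 1) - V * G.d i) = 0)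
    (fun i V W => G.d (i + 1) * W = e (i + 1) - V * G.d i)
    (x := W) (by rw [Matrix.mul_sub, he, ← Matrix.mul_assoc, hW, sub_self])
    (by
      rintro i V hV
      obtain ⟨W, hW⟩ := G.exists_d_mul_eq hV
      refine ⟨W, ?_, hW⟩
      rw [Matrix.mul_sub, he, ← Matrix.mul_assoc, hW, Matrix.sub_mul, Matrix.mul_assoc V,
        G.d_mul_d, Matrix.mul_zero, sub_zero, sub_self])
  refine ⟨h, by rw [hW', hW], fun i => ?_⟩
  rw [hr, sub_add_cancel]

instance (i : ℕ) (a : ℤ) : Fintype {b : F.ι i // F.deg i b = a} := Fintype.ofFinite _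

lemma tensorD_apply (i : ℕ) (a : ℤ) (x : F.TensorComponent (i + 1) a) :
    F.tensorD i a x = (reduceAt (F.deg i) (F.deg (i + 1)) a (F.d i)).mulVec x := rfl

/-- With comparison maps `u : F → G` and `v : G → F`, write a cycle as `x = u v x - (u v - 1) x`.
The first term is a boundary because `v x` is a cycle of `F`, the second because `u v - 1` is
null-homotopic. -/
lemma cycles_le_boundaries_of_comparison (hind : iSupIndep 𝓜) (hsmul : SMulMem n 𝓜) {i : ℕ} {a : ℤ}
    (hF : F.cycles i a ≤ F.boundaries i a) : G.cycles i a ≤ G.boundaries i a := by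
  classical
  obtain ⟨u, hu, hud, huε⟩ := exists_chainMap F G hind hsmul
  obtain ⟨v, hv, hvd, hvε⟩ := exists_chainMap G F hind hsmul
  obtain ⟨h, hh0, hh⟩ := G.exists_homotopy (e := fun i => u i * v i - 1)
    (fun i => by
      rw [Matrix.mul_sub, ← Matrix.mul_assoc, hud, Matrix.mul_assoc, hvd, ← Matrix.mul_assoc,
        Matrix.sub_mul, Matrix.mul_one, Matrix.one_mul])
    (fun b => by
      have hb : (u 0 * v 0 - 1).col b
          = (u 0).mulVec ((v 0).mulVec (Pi.single b 1)) - Pi.single b 1 := by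
        rw [Matrix.mulVec_mulVec, Matrix.mulVec_single_one]
        ext1 c
        simp only [Matrix.col_apply, Matrix.sub_apply, Pi.sub_apply, Matrix.one_apply,
          Pi.single_apply]
      rw [hb, map_sub, huε, hvε, sub_self])
  let ρ : ∀ k, Matrix _ _ K := fun k => reduceAt (G.deg k) (F.deg k) a (u k)
  let τ : ∀ k, Matrix _ _ K := fun k => reduceAt (F.deg k) (G.deg k) a (v k)
  let η : ∀ k, Matrix _ _ K := fun k => reduceAt (G.deg (k + 1)) (G.deg k) a (h k)
  let δ : ∀ k, Matrix _ _ K := fun k => reduceAt (G.deg k) (G.deg (k + 1)) a (G.d k)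
  have hone : ∀ k, reduceAt (G.deg k) (G.deg k) a (u k * v k - 1) = ρ k * τ k - 1 := fun k => by
    rw [← reduceAt_mul_of_left (hu k)]
    ext ⟨c, hc⟩ ⟨b, hb⟩
    simp [reduceAt_apply, Matrix.one_apply]
  have hτ : ∀ x : G.TensorComponent i a, x ∈ G.cycles i a →
      (τ i).mulVec x ∈ F.cycles i a := fun x hx => by
    cases i with
    | zero => trivial
    | succ i =>
      have hx' : (δ i).mulVec x = 0 := hx
      change (reduceAt (F.deg i) (F.deg (i + 1)) a (F.d i)).mulVec ((τ (i + 1)).mulVec x) = 0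
      rw [Matrix.mulVec_mulVec, ← reduceAt_mul_of_left (F.homogeneous_d i), hvd,
        reduceAt_mul_of_left (hv i), ← Matrix.mulVec_mulVec, hx', Matrix.mulVec_zero]
  have hρ : ∀ y : F.TensorComponent i a, y ∈ F.boundaries i a →
      (ρ i).mulVec y ∈ G.boundaries i a := by
    rintro _ ⟨y, rfl⟩
    refine ⟨(ρ (i + 1)).mulVec y, ?_⟩
    rw [tensorD_apply, tensorD_apply, Matrix.mulVec_mulVec, Matrix.mulVec_mulVec,
      ← reduceAt_mul_of_left (G.homogeneous_d i), hud, reduceAt_mul_of_left (hu i)]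
  intro x hx
  have key : (ρ i * τ i - 1).mulVec x ∈ G.boundaries i a := by
    rw [← hone]
    cases i with
    | zero =>
      rw [hh0, reduceAt_mul_of_left (G.homogeneous_d 0), ← Matrix.mulVec_mulVec]
      exact ⟨_, rfl⟩
    | succ i =>
      have hx' : (δ i).mulVec x = 0 := hx
      have hadd : reduceAt (G.deg (i + 1)) (G.deg (i + 1)) a (u (i + 1) * v (i + 1) - 1)
          = δ (i + 1) * η (i + 1) + η i * δ i := by
        rw [hh, ← reduceAt_mul_of_left (G.homogeneous_d (i + 1)),
          ← reduceAt_mul_of_right (G.homogeneous_d i)]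
        ext ⟨c, hc⟩ ⟨b, hb⟩
        simp only [reduceAt_apply, Matrix.add_apply, map_add]
      rw [hadd, Matrix.add_mulVec, ← Matrix.mulVec_mulVec, ← Matrix.mulVec_mulVec x, hx',
        Matrix.mulVec_zero, add_zero]
      exact ⟨_, rfl⟩
  have hfin := (G.boundaries i a).sub_mem (hρ _ (hF (hτ x hx))) key
  rwa [Matrix.sub_mulVec, Matrix.mulVec_mulVec, Matrix.one_mulVec, sub_sub_cancel] at hfin

lemma nontrivial_tor_iff (i : ℕ) (a : ℤ) :
    Nontrivial (F.Tor i a) ↔ ¬ F.cycles i a ≤ F.boundaries i a := by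
  rw [Submodule.Quotient.nontrivial_iff, Ne, Submodule.submoduleOf_eq_top]

lemma gradedBetti_ne_zero_iff (hind : iSupIndep 𝓜) (hsmul : SMulMem n 𝓜) (i : ℕ) (a : ℤ) :
    gradedBetti n 𝓜 i a ≠ 0 ↔ ¬ F.cycles i a ≤ F.boundaries i a := by
  have h : Nonempty (GradedFreeResolution n 𝓜) := ⟨F⟩
  rw [gradedBetti, dif_pos h, ← Nat.pos_iff_ne_zero, Module.finrank_pos_iff, nontrivial_tor_iff,
    not_iff_not]
  exact ⟨cycles_le_boundaries_of_comparison _ _ hind hsmul,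
    cycles_le_boundaries_of_comparison _ _ hind hsmul⟩

/-- In a minimal resolution the differentials of `K ⊗ F` vanish, so Tor is all of `K ⊗ Fᵢ`. -/
lemma gradedBetti_ne_zero_iff_of_minimal (hind : iSupIndep 𝓜) (hsmul : SMulMem n 𝓜)
    (hmin : ∀ i c b, constantCoeff (F.d i c b) = 0) (i : ℕ) (a : ℤ) :
    gradedBetti n 𝓜 i a ≠ 0 ↔ ∃ b, F.deg i b = a := by
  have hD : ∀ i a, F.tensorD i a = 0 := fun i a => by
    ext1 x
    ext1 c
    simp [tensorD_apply, reduceAt, Matrix.mulVec, dotProduct, hmin]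
  rw [F.gradedBetti_ne_zero_iff hind hsmul]
  have hc : F.cycles i a = ⊤ := by
    cases i with
    | zero => rfl
    | succ i => rw [cycles, hD, LinearMap.ker_zero]
  rw [hc, boundaries, hD, LinearMap.range_zero, top_le_iff, ← Ne]
  refine ⟨fun h => ?_, fun ⟨b, hb⟩ h => ?_⟩
  · by_contra! h'
    have : IsEmpty {b // F.deg i b = a} := ⟨fun b => h' b b.2⟩
    exact h (Subsingleton.elim _ _)
  · have h1 : (fun _ => 1 : F.TensorComponent i a) ∈ (⊥ : Submodule K _) := h ▸ trivial
    exact one_ne_zero (congrFun ((Submodule.mem_bot K).1 h1) ⟨b, hb⟩)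

end GradedFreeResolution

end Comparison

end

noncomputable section

/-! ### The Koszul complex of a regular sequence as an iterated mapping cone -/

section Koszul

/-- A set indexing the basis of the `i`-th module of the Koszul complex of `t` elements. -/
def koszulIndex : ℕ → ℕ → Type
  | 0, 0 => Unit
  | 0, _ + 1 => Empty
  | t + 1, 0 => koszulIndex t 0
  | t + 1, i + 1 => koszulIndex t (i + 1) ⊕ koszulIndex t i

instance koszulIndexFintype : ∀ t i, Fintype (koszulIndex t i)
  | 0, 0 => inferInstanceAs (Fintype Unit)
  | 0, _ + 1 => inferInstanceAs (Fintype Empty)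
  | t + 1, 0 => koszulIndexFintype t 0
  | t + 1, i + 1 =>
    letI := koszulIndexFintype t (i + 1)
    letI := koszulIndexFintype t i
    inferInstanceAs (Fintype (koszulIndex t (i + 1) ⊕ koszulIndex t i))

instance koszulIndexDecidableEq : ∀ t i, DecidableEq (koszulIndex t i)
  | 0, 0 => inferInstanceAs (DecidableEq Unit)
  | 0, _ + 1 => inferInstanceAs (DecidableEq Empty)
  | t + 1, 0 => koszulIndexDecidableEq t 0
  | t + 1, i + 1 =>
    letI := koszulIndexDecidableEq t (i + 1)
    letI := koszulIndexDecidableEq t i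
    inferInstanceAs (DecidableEq (koszulIndex t (i + 1) ⊕ koszulIndex t i))

instance koszulIndexUnique : ∀ t, Unique (koszulIndex t 0)
  | 0 => inferInstanceAs (Unique Unit)
  | t + 1 => koszulIndexUnique t

lemma koszulIndex_isEmpty : ∀ {t i : ℕ}, t < i → IsEmpty (koszulIndex t i)
  | 0, 0, h => absurd h (lt_irrefl 0)
  | 0, _ + 1, _ => inferInstanceAs (IsEmpty Empty)
  | _ + 1, 0, h => absurd h (Nat.not_lt_zero _)
  | t + 1, i + 1, h => by
    have := koszulIndex_isEmpty (Nat.lt_of_succ_lt_succ h)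
    have := koszulIndex_isEmpty ((Nat.lt_of_succ_lt_succ h).trans i.lt_succ_self)
    exact inferInstanceAs (IsEmpty (koszulIndex t (i + 1) ⊕ koszulIndex t i))

/-- The degrees of the basis elements of the Koszul complex of elements of degrees `a k`. -/
def koszulDeg (a : ℕ → ℤ) : ∀ t i, koszulIndex t i → ℤ
  | 0, _ => 0
  | t + 1, 0 => koszulDeg a t 0
  | t + 1, i + 1 => Sum.elim (koszulDeg a t (i + 1)) fun b => a t + koszulDeg a t i b

lemma koszulDeg_zero (a : ℕ → ℤ) (t : ℕ) (b : koszulIndex t 0) : koszulDeg a t 0 b = 0 := by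
  induction t with
  | zero => rfl
  | succ t ih => exact ih b

lemma koszulDeg_eq {a : ℕ → ℤ} {t : ℕ} (ha : ∀ k < t, a k = 1) (i : ℕ) (b : koszulIndex t i) :
    koszulDeg a t i b = i := by
  induction t generalizing i with
  | zero =>
    cases i with
    | zero => rfl
    | succ i => exact b.elim
  | succ t ih =>
    have ih := ih fun k hk => ha k (hk.trans t.lt_succ_self)
    cases i with
    | zero => exact ih 0 b
    | succ i =>
      rcases b with b | b
      · exact ih _ b
      · change a t + koszulDeg a t i b = _
        rw [ih, ha t t.lt_succ_self]
        push_cast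
        ring

variable {R : Type*} [CommRing R]

/-- The matrices of the differentials of the Koszul complex of `z 0, …, z (t - 1)`, built as an
iterated mapping cone. -/
def koszulMatrix (z : ℕ → R) : ∀ t i, Matrix (koszulIndex t i) (koszulIndex t (i + 1)) R
  | 0, _ => 0
  | t + 1, 0 => (Matrix.fromCols (koszulMatrix z t 0) (Matrix.diagonal fun _ => z t) :
      Matrix (koszulIndex t 0) (koszulIndex t 1 ⊕ koszulIndex t 0) R)
  | t + 1, i + 1 => (Matrix.fromBlocks (koszulMatrix z t (i + 1))
      (Matrix.diagonal fun _ => (-1) ^ (i + 1) * z t) 0 (koszulMatrix z t i) : Matrix (koszulIndex t (i + 1) ⊕ koszulIndex t i)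
        (koszulIndex t (i + 2) ⊕ koszulIndex t (i + 1)) R)

lemma koszulMatrix_succ_zero_mulVec (z : ℕ → R) (t : ℕ) (u : koszulIndex t 1 → R)
    (v : koszulIndex t 0 → R) :
    (koszulMatrix z (t + 1) 0).mulVec (Sum.elim u v : koszulIndex t 1 ⊕ koszulIndex t 0 → R) =
      (koszulMatrix z t 0).mulVec u + z t • v := by
  refine (Matrix.fromCols_mulVec _ _ _).trans ?_
  congr 1
  ext1 x
  exact Matrix.mulVec_diagonal _ _ x

lemma koszulMatrix_succ_succ_mulVec (z : ℕ → R) (t i : ℕ) (u : koszulIndex t (i + 2) → R)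
    (v : koszulIndex t (i + 1) → R) :
    (koszulMatrix z (t + 1) (i + 1)).mulVec
        (Sum.elim u v : koszulIndex t (i + 2) ⊕ koszulIndex t (i + 1) → R) =
      (Sum.elim ((koszulMatrix z t (i + 1)).mulVec u + ((-1) ^ (i + 1) * z t) • v)
        ((koszulMatrix z t i).mulVec v) : koszulIndex t (i + 1) ⊕ koszulIndex t i → R) := by
  refine (Matrix.fromBlocks_mulVec _ _ _ _ _).trans ?_
  rw [Matrix.zero_mulVec, zero_add]
  congr 2
  ext1 x
  exact Matrix.mulVec_diagonal _ _ x

/-- Every entry of the Koszul differentials is, up to sign, one of the given elements or `0`. -/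
lemma koszulMatrix_induction (z : ℕ → R) (a : ℕ → ℤ) {t : ℕ} {P : R → ℤ → Prop}
    (h0 : ∀ k, P 0 k) (hneg : ∀ f k, P f k → P (-f) k) (hz : ∀ k < t, P (z k) (a k)) (i : ℕ)
    (c : koszulIndex t i) (b : koszulIndex t (i + 1)) :
    P (koszulMatrix z t i c b) (koszulDeg a t (i + 1) b - koszulDeg a t i c) := by
  induction t generalizing i with
  | zero => exact b.elim
  | succ t ih =>
    have ih := ih fun k hk => hz k (hk.trans t.lt_succ_self)
    have hzt := hz t t.lt_succ_self
    cases i with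
    | zero =>
      rcases b with b | b
      · exact ih 0 c b
      · change P ((Matrix.diagonal fun _ => z t : Matrix (koszulIndex t 0) (koszulIndex t 0) R) c b)
          (a t + koszulDeg a t 0 b - koszulDeg a t 0 c)
        obtain rfl : b = c := Subsingleton.elim (α := koszulIndex t 0) b c
        rwa [Matrix.diagonal_apply_eq, add_sub_cancel_right]
    | succ i =>
      rcases c with c | c <;> rcases b with b | b
      · exact ih (i + 1) c b
      · change P (Matrix.diagonal (fun _ => (-1) ^ (i + 1) * z t) c b)
          (a t + koszulDeg a t (i + 1) b - koszulDeg a t (i + 1) c)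
        by_cases hbc : c = b
        · subst hbc
          rw [Matrix.diagonal_apply_eq, add_sub_cancel_right]
          rcases neg_one_pow_eq_or R (i + 1) with h | h <;> rw [h]
          · rwa [one_mul]
          · rw [neg_one_mul]
            exact hneg _ _ hzt
        · rw [Matrix.diagonal_apply_ne _ hbc]
          exact h0 _
      · exact h0 _
      · change P (koszulMatrix z t i c b) (a t + koszulDeg a t (i + 1) b - (a t + koszulDeg a t i c))
        rw [add_sub_add_left_eq_sub]
        exact ih i c b

/-- The alternating sign on the block `z t` makes the two mixed terms of the cone cancel. -/
lemma koszulMatrix_mulVec_mulVec (z : ℕ → R) (t i : ℕ) (w : koszulIndex t (i + 2) → R) :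
    (koszulMatrix z t i).mulVec ((koszulMatrix z t (i + 1)).mulVec w) = 0 := by
  induction t generalizing i with
  | zero => exact Matrix.zero_mulVec _
  | succ t ih =>
    obtain ⟨u, v, rfl⟩ : ∃ (u : koszulIndex t (i + 2) → R) (v : koszulIndex t (i + 1) → R),
        w = (Sum.elim u v : koszulIndex t (i + 2) ⊕ koszulIndex t (i + 1) → R) :=
      ⟨_, _, (Sum.elim_comp_inl_inr w).symm⟩
    rw [koszulMatrix_succ_succ_mulVec]
    cases i with
    | zero =>
      rw [koszulMatrix_succ_zero_mulVec, Matrix.mulVec_add, ih, Matrix.mulVec_smul]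
      ext1 x
      simp
      rfl
    | succ i =>
      rw [koszulMatrix_succ_succ_mulVec, Matrix.mulVec_add, ih, ih, Matrix.mulVec_smul, zero_add,
        ← add_smul]
      have : ((-1) ^ (i + 1 + 1) * z t + (-1) ^ (i + 1) * z t : R) = 0 := by ring
      rw [this, zero_smul]
      exact Sum.elim_zero_zero

lemma mem_span_iff_koszulMatrix (z : ℕ → R) (t : ℕ) (f : R) :
    f ∈ Ideal.span (z '' Set.Iio t) ↔
      ∃ w, (koszulMatrix z t 0).mulVec w = fun _ => f := by
  induction t generalizing f with
  | zero =>
    have : ∀ w, (koszulMatrix z 0 0).mulVec w = 0 := fun w => Matrix.zero_mulVec w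
    simp only [this]
    simp [funext_iff, eq_comm]
  | succ t ih =>
    rw [show Set.Iio (t + 1) = insert t (Set.Iio t) by ext; simp, Set.image_insert_eq,
      Ideal.mem_span_insert]
    constructor
    · rintro ⟨c, g, hg, rfl⟩
      obtain ⟨w, hw⟩ := (ih g).1 hg
      refine ⟨(Sum.elim w fun _ => c : koszulIndex t 1 ⊕ koszulIndex t 0 → R), ?_⟩
      rw [koszulMatrix_succ_zero_mulVec, hw]
      ext1 x
      simp [mul_comm, add_comm]
    · rintro ⟨w, hw⟩
      obtain ⟨u, v, rfl⟩ : ∃ (u : koszulIndex t 1 → R) (v : koszulIndex t 0 → R),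
          w = (Sum.elim u v : koszulIndex t 1 ⊕ koszulIndex t 0 → R) :=
        ⟨_, _, (Sum.elim_comp_inl_inr w).symm⟩
      rw [koszulMatrix_succ_zero_mulVec] at hw
      refine ⟨v default, (koszulMatrix z t 0).mulVec u default, (ih _).2 ⟨u, ?_⟩, ?_⟩
      · ext1 x
        rw [Subsingleton.elim x default]
      · have := congrFun hw (default : koszulIndex t 0)
        rw [← this, add_comm, mul_comm]
        rfl

/-- Induction on `t` along the mapping cone of multiplication by `z t`. In positive homological
degree only exactness of the smaller complex matters; regularity of `z t` enters at the bottom,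
where that complex has homology `R / (z 0, …, z (t - 1))`. -/
lemma koszulMatrix_exact {z : ℕ → R} {t : ℕ}
    (hz : ∀ k < t, ∀ f, z k * f ∈ Ideal.span (z '' Set.Iio k) → f ∈ Ideal.span (z '' Set.Iio k))
    (i : ℕ) {w : koszulIndex t (i + 1) → R} (hw : (koszulMatrix z t i).mulVec w = 0) :
    ∃ w', (koszulMatrix z t (i + 1)).mulVec w' = w := by
  induction t generalizing i with
  | zero => exact ⟨0, funext fun b => b.elim⟩
  | succ t ih =>
    have ih := fun i => @ih (fun k hk => hz k (hk.trans t.lt_succ_self)) i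
    obtain ⟨u, v, rfl⟩ : ∃ (u : koszulIndex t (i + 1) → R) (v : koszulIndex t i → R),
        w = (Sum.elim u v : koszulIndex t (i + 1) ⊕ koszulIndex t i → R) :=
      ⟨_, _, (Sum.elim_comp_inl_inr w).symm⟩
    -- At `i = 0` the cycle condition puts `z t * v` in the ideal of the earlier elements, and
    -- regularity puts `v` there; for larger `i` the component `v` is itself a cycle.
    obtain ⟨x, hx⟩ : ∃ x, (koszulMatrix z t i).mulVec x = v := by
      cases i with
      | zero =>
        rw [koszulMatrix_succ_zero_mulVec] at hw
        have hv : v = fun _ => v default := funext fun x => by rw [Subsingleton.elim x default]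
        rw [hv]
        refine (mem_span_iff_koszulMatrix z t _).1 (hz t t.lt_succ_self _ ?_)
        refine (mem_span_iff_koszulMatrix z t _).2 ⟨-u, ?_⟩
        have hw : (koszulMatrix z t 0).mulVec u + z t • v = 0 := hw
        refine (Matrix.mulVec_neg _ _).trans ((neg_eq_of_add_eq_zero_right hw).trans ?_)
        ext1 x
        rw [Subsingleton.elim x default]
        rfl
      | succ i =>
        rw [koszulMatrix_succ_succ_mulVec] at hw
        exact ih i (funext fun b => congrFun hw (Sum.inr b))
    -- Subtracting the contribution of `x` to the first component leaves a cycle of the smaller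
    -- complex.
    have hu : (koszulMatrix z t i).mulVec (u - ((-1) ^ (i + 1) * z t) • x) = 0 := by
      rw [Matrix.mulVec_sub, Matrix.mulVec_smul, hx]
      cases i with
      | zero =>
        rw [koszulMatrix_succ_zero_mulVec] at hw
        have hw : (koszulMatrix z t 0).mulVec u + z t • v = 0 := hw
        rw [← hw]
        ext1 x
        simp
      | succ i =>
        rw [koszulMatrix_succ_succ_mulVec] at hw
        have h : (koszulMatrix z t (i + 1)).mulVec u + ((-1) ^ (i + 1) * z t) • v = 0 :=
          funext fun b => congrFun hw (Sum.inl b)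
        rw [← h, sub_eq_add_neg, ← neg_smul]
        congr 2
        ring
    obtain ⟨y, hy⟩ := ih i hu
    refine ⟨(Sum.elim y x : koszulIndex t (i + 2) ⊕ koszulIndex t (i + 1) → R), ?_⟩
    rw [koszulMatrix_succ_succ_mulVec, hx, hy, sub_add_cancel]

end Koszul

end

noncomputable section

/-! ### Strands of fixed `y`-degree of a complex over `A[y]` with linear differentials -/

section Strand

variable {A : Type*} [CommRing A] {m : ℕ} {κ μ : Type*}

/-- Exponents of the monomials of degree `j - i` in `m` variables (none if `j < i`). -/
abbrev StrandExponent (m j i : ℕ) : Type := {α : Fin m →₀ ℕ // α.degree + i = j}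

instance (m j i : ℕ) : Finite (StrandExponent m j i) :=
  (Finsupp.finite_of_degree_le (σ := Fin m) j).subset fun α (hα : α.degree + i = j) =>
    (show α.degree ≤ j by omega)

instance (m j i : ℕ) : Fintype (StrandExponent m j i) := Fintype.ofFinite _

/-- The element of `⨁ A[y](-i)` of degree `j` with the given coefficients. -/
def ofStrand (j i : ℕ) (g : κ × StrandExponent m j i → A) (b : κ) : MvPolynomial (Fin m) A :=
  ∑ α : StrandExponent m j i, monomial α.1 (g (b, α))

/-- The coefficients of the degree `j` part of an element of `⨁ A[y](-i)`. -/
def toStrand (j i : ℕ) (w : κ → MvPolynomial (Fin m) A) (x : κ × StrandExponent m j i) : A :=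
  coeff x.2.1 (w x.1)

/-- The matrix over `A` of the degree `j` part of the map `⨁ A[y](-i-1) → ⨁ A[y](-i)` given by a
matrix of linear forms in `y`. -/
def strandMatrix (j i : ℕ) (D : Matrix κ μ (MvPolynomial (Fin m) A)) :
    Matrix (κ × StrandExponent m j i) (μ × StrandExponent m j (i + 1)) A :=
  fun c b => coeff c.2.1 (D c.1 b.1 * monomial b.2.1 1)

lemma toStrand_ofStrand (j i : ℕ) (g : κ × StrandExponent m j i → A) :
    toStrand j i (ofStrand j i g) = g := by
  classical
  ext1 ⟨b, α⟩
  simp only [toStrand, ofStrand, coeff_sum, coeff_monomial]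
  rw [Finset.sum_eq_single α]
  · rw [if_pos rfl]
  · exact fun β _ h => if_neg fun h' => h (Subtype.ext h')
  · simp

lemma ofStrand_toStrand {j i : ℕ} {w : κ → MvPolynomial (Fin m) A}
    (hw : ∀ b β, coeff β (w b) ≠ 0 → β.degree + i = j) : ofStrand j i (toStrand j i w) = w := by
  classical
  ext1 b
  ext1 β
  simp only [toStrand, ofStrand, coeff_sum, coeff_monomial]
  by_cases h : β.degree + i = j
  · rw [Finset.sum_eq_single (⟨β, h⟩ : StrandExponent m j i)]
    · rw [if_pos rfl]
    · exact fun α _ h' => if_neg fun h'' => h' (Subtype.ext h'')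
    · simp
  · rw [Finset.sum_eq_zero fun α _ => if_neg fun (h' : α.1 = β) => h (h' ▸ α.2)]
    by_contra h'
    exact h (hw b β (Ne.symm h'))

lemma ofStrand_homogeneous {j i : ℕ} (g : κ × StrandExponent m j i → A) (b : κ)
    (β : Fin m →₀ ℕ) (h : coeff β (ofStrand j i g b) ≠ 0) : β.degree + i = j := by
  classical
  by_contra h'
  refine h ?_
  simp only [ofStrand, coeff_sum, coeff_monomial]
  exact Finset.sum_eq_zero fun α _ => if_neg fun (h'' : α.1 = β) => h' (h'' ▸ α.2)

/-- As `f` is linear, a monomial of degree `j - i` in the product only receives monomials of `p` of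
degree `j - i - 1`. -/
lemma coeff_mul_eq_sum_strand {f : MvPolynomial (Fin m) A} (hf : f.IsHomogeneous 1) {j i : ℕ}
    (β : StrandExponent m j i) (p : MvPolynomial (Fin m) A) :
    coeff β.1 (f * p) =
      ∑ α : StrandExponent m j (i + 1), coeff β.1 (f * monomial α.1 1) * coeff α.1 p := by
  classical
  induction p using MvPolynomial.induction_on' with
  | add p q hp hq => simp only [mul_add, coeff_add, hp, hq, Finset.sum_add_distrib]
  | monomial γ r =>
    have hγ : f * monomial γ r = C r * (f * monomial γ 1) := by
      rw [mul_left_comm, C_mul_monomial, mul_one]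
    rw [hγ, coeff_C_mul]
    by_cases h : γ.degree + (i + 1) = j
    · rw [Finset.sum_eq_single (⟨γ, h⟩ : StrandExponent m j (i + 1))]
      · rw [coeff_monomial, if_pos rfl, mul_comm]
      · intro α _ hα
        rw [coeff_monomial, if_neg fun h' => hα (Subtype.ext h'.symm), mul_zero]
      · simp
    · rw [Finset.sum_eq_zero fun α _ => by
        rw [coeff_monomial, if_neg fun h' : γ = α.1 => h (h' ▸ α.2), mul_zero]]
      have h1 := hf.mul (isHomogeneous_monomial (1 : A) (rfl : γ.degree = γ.degree))
      rw [h1.coeff_eq_zero, mul_zero]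
      have := β.2
      omega

variable [Fintype μ]

lemma toStrand_mulVec {D : Matrix κ μ (MvPolynomial (Fin m) A)}
    (hD : ∀ c b, (D c b).IsHomogeneous 1) (j i : ℕ) (w : μ → MvPolynomial (Fin m) A) :
    toStrand j i (D.mulVec w) = (strandMatrix j i D).mulVec (toStrand j (i + 1) w) := by
  ext1 ⟨c, β⟩
  simp only [toStrand, Matrix.mulVec, dotProduct, coeff_sum, strandMatrix, Fintype.sum_prod_type]
  exact Finset.sum_congr rfl fun b _ => coeff_mul_eq_sum_strand (hD c b) β (w b)

lemma ofStrand_mulVec {D : Matrix κ μ (MvPolynomial (Fin m) A)}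
    (hD : ∀ c b, (D c b).IsHomogeneous 1) (j i : ℕ) (g : μ × StrandExponent m j (i + 1) → A) :
    ofStrand j i ((strandMatrix j i D).mulVec g) = D.mulVec (ofStrand j (i + 1) g) := by
  rw [← toStrand_ofStrand j (i + 1) g, ← toStrand_mulVec hD, toStrand_ofStrand]
  refine ofStrand_toStrand fun c β h => ?_
  rw [Matrix.mulVec, dotProduct, coeff_sum] at h
  obtain ⟨b, -, hb⟩ := Finset.exists_ne_zero_of_sum_ne_zero h
  rw [coeff_mul] at hb
  obtain ⟨⟨γ, α⟩, hγα, hb⟩ := Finset.exists_ne_zero_of_sum_ne_zero hb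
  have h1 : γ.degree = 1 := by
    by_contra h1
    exact hb (by rw [(hD c b).coeff_eq_zero h1, zero_mul])
  have h2 := ofStrand_homogeneous g b α (right_ne_zero_of_mul hb)
  rw [← Finset.HasAntidiagonal.mem_antidiagonal.1 hγα, map_add]
  dsimp only
  omega

/-- A preimage over `A[y]` may be cut down to its part of the right degree, so exactness over `A[y]`
passes to every strand. -/
lemma exists_strandMatrix_mulVec_iff {D : Matrix κ μ (MvPolynomial (Fin m) A)}
    (hD : ∀ c b, (D c b).IsHomogeneous 1) (j i : ℕ) (g : κ × StrandExponent m j i → A) :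
    (∃ h, (strandMatrix j i D).mulVec h = g) ↔ ∃ w, D.mulVec w = ofStrand j i g := by
  constructor
  · rintro ⟨h, rfl⟩
    exact ⟨_, (ofStrand_mulVec hD j i h).symm⟩
  · rintro ⟨w, hw⟩
    exact ⟨toStrand j (i + 1) w, by rw [← toStrand_mulVec hD, hw, toStrand_ofStrand]⟩

end Strand

/-! ### The identification `K[x, y] ≃ K[x][y]` and the bigrading -/

section SplitVariables

variable {n m : ℕ} {K : Type*} [Field K]

lemma weight_bideg (γ : Fin n →₀ ℕ) (β : Fin m →₀ ℕ) :
    Finsupp.weight (bideg n m) (γ.sumElim β) =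
      (Finsupp.weight (fun _ : Fin n => (1 : ℤ)) γ, (β.degree : ℤ)) := by
  simp [Finsupp.weight_apply, Finsupp.sum_fintype, bideg, Finsupp.degree_eq_sum, Prod.ext_iff,
    Prod.fst_sum, Prod.snd_sum]

/-- `K[x, y] ≃ K[x][y]`. -/
def splitVariables (n m : ℕ) (K : Type*) [Field K] :
    BiPoly n m K ≃ₐ[K] MvPolynomial (Fin m) (MvPolynomial (Fin n) K) :=
  (renameEquiv K (Equiv.sumComm (Fin n) (Fin m))).trans (sumAlgEquiv K (Fin m) (Fin n))

lemma coeff_splitVariables (f : BiPoly n m K) (γ : Fin n →₀ ℕ) (β : Fin m →₀ ℕ) :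
    coeff γ (coeff β (splitVariables n m K f)) = coeff (γ.sumElim β) f := by
  classical
  induction f using MvPolynomial.induction_on' with
  | add p q hp hq => simp only [map_add, coeff_add, hp, hq]
  | monomial d r =>
    obtain ⟨⟨γ', β'⟩, rfl⟩ := Finsupp.sumFinsuppEquivProdFinsupp.symm.surjective d
    change coeff γ (coeff β (splitVariables n m K (monomial (γ'.sumElim β') r))) =
      coeff _ (monomial (γ'.sumElim β') r)
    have h : splitVariables n m K (monomial (γ'.sumElim β') r) = monomial β' (monomial γ' r) := by
      rw [splitVariables, AlgEquiv.trans_apply, renameEquiv_apply, Equiv.sumComm_apply,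
        rename_monomial, Finsupp.mapDomain_swap_sumElim]
      have : Finsupp.sumFinsuppAddEquivProdFinsupp (β'.sumElim γ') = (β', γ') :=
        Finsupp.sumFinsuppEquivProdFinsupp.apply_symm_apply (β', γ')
      simp [sumAlgEquiv, monomial, this]
    have h' : γ'.sumElim β' = γ.sumElim β ↔ β' = β ∧ γ' = γ := by
      refine ⟨fun h => ?_, fun h => by rw [h.1, h.2]⟩
      have := Finsupp.sumFinsuppEquivProdFinsupp.symm.injective (a₁ := (γ', β')) (a₂ := (γ, β)) h
      exact ⟨congrArg Prod.snd this, congrArg Prod.fst this⟩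
    rw [h, coeff_monomial, coeff_monomial]
    split_ifs <;> simp_all [coeff_monomial]

lemma splitVariables_algebraMap (p : MvPolynomial (Fin n) K) :
    splitVariables n m K (algebraMap _ _ p) = C p := by
  have h : (splitVariables n m K).toAlgHom.comp (rename Sum.inl) =
      IsScalarTower.toAlgHom K (MvPolynomial (Fin n) K)
        (MvPolynomial (Fin m) (MvPolynomial (Fin n) K)) := by
    ext1 i
    simp [splitVariables, MvPolynomial.algebraMap_eq]
  exact DFunLike.congr_fun h p

lemma splitVariables_symm_C (p : MvPolynomial (Fin n) K) :
    (splitVariables n m K).symm (C p) = algebraMap _ _ p := by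
  rw [← splitVariables_algebraMap, AlgEquiv.symm_apply_apply]

lemma isWeightedHomogeneous_coeff_splitVariables {f : BiPoly n m K} {a b : ℤ}
    (hf : IsWeightedHomogeneous (bideg n m) f (a, b)) (β : Fin m →₀ ℕ) :
    IsWeightedHomogeneous (fun _ : Fin n => (1 : ℤ)) (coeff β (splitVariables n m K f)) a := by
  intro γ h
  rw [coeff_splitVariables] at h
  exact congrArg Prod.fst ((weight_bideg γ β).symm.trans (hf h))

lemma degree_eq_of_coeff_splitVariables {f : BiPoly n m K} {a b : ℤ}
    (hf : IsWeightedHomogeneous (bideg n m) f (a, b)) {β : Fin m →₀ ℕ}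
    (h : coeff β (splitVariables n m K f) ≠ 0) : (β.degree : ℤ) = b := by
  obtain ⟨γ, hγ⟩ := ne_zero_iff.1 h
  rw [coeff_splitVariables] at hγ
  exact congrArg Prod.snd ((weight_bideg γ β).symm.trans (hf hγ))

lemma isWeightedHomogeneous_splitVariables_symm {p : MvPolynomial (Fin n) K} {a : ℤ}
    (hp : IsWeightedHomogeneous (fun _ : Fin n => (1 : ℤ)) p a) (α : Fin m →₀ ℕ) :
    IsWeightedHomogeneous (bideg n m) ((splitVariables n m K).symm (monomial α p))
      (a, (α.degree : ℤ)) := by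
  classical
  intro d hd
  obtain ⟨⟨γ, β⟩, rfl⟩ := Finsupp.sumFinsuppEquivProdFinsupp.symm.surjective d
  change coeff (γ.sumElim β) _ ≠ 0 at hd
  change Finsupp.weight _ (γ.sumElim β) = _
  rw [← coeff_splitVariables, AlgEquiv.apply_symm_apply, coeff_monomial] at hd
  split_ifs at hd with h
  · subst h
    rw [weight_bideg, hp hd]
  · exact absurd (coeff_zero _) hd

lemma isWeightedHomogeneous_algebraMap {p : MvPolynomial (Fin n) K} {a : ℤ}
    (hp : IsWeightedHomogeneous (fun _ : Fin n => (1 : ℤ)) p a) :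
    IsWeightedHomogeneous (bideg n m) (algebraMap (MvPolynomial (Fin n) K) (BiPoly n m K) p)
      (a, 0) := by
  simpa [← splitVariables_symm_C] using isWeightedHomogeneous_splitVariables_symm (m := m) hp 0

end SplitVariables

/-! ### The `x`-grading on the rows of `R` -/

section RowGrading

variable {n m : ℕ} {K : Type*} [Field K] {J : Ideal (BiPoly n m K)}

lemma smulMem_rowGrading (J : Ideal (BiPoly n m K)) (b : ℤ) :
    GradedFreeResolution.SMulMem n (rowGrading J b) := by
  rintro p k a hp ⟨x, hx⟩ ⟨f, hf, rfl⟩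
  refine ⟨algebraMap _ _ p * f, ?_, ?_⟩
  · have h := (isWeightedHomogeneous_algebraMap (m := m) hp).mul hf
    simpa using h
  · rw [← Algebra.smul_def]
    rfl

attribute [local instance] MvPolynomial.weightedGradedAlgebra in
-- Since `J` is homogeneous, the projection onto bidegree `(a, b)` descends to `S/J`; it fixes the
-- piece of degree `a` and kills the others.
lemma iSupIndep_rowGrading
    (hJ : J.IsHomogeneous (weightedHomogeneousSubmodule K (bideg n m))) (b : ℤ) :
    iSupIndep (rowGrading J b) := by
  classical
  let π : ℤ → (BiPoly n m K ⧸ J) →ₗ[K] BiPoly n m K ⧸ J := fun a =>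
    Submodule.mapQ (J.restrictScalars K) (J.restrictScalars K)
      (weightedHomogeneousComponent (bideg n m) (a, b))
      fun f hf => weightedHomogeneousComponent_mem_of_mem K (bideg n m) hJ hf _
  have hπ : ∀ (a : ℤ) (f : BiPoly n m K), π a (Ideal.Quotient.mk J f) =
      Ideal.Quotient.mk J (weightedHomogeneousComponent (bideg n m) (a, b) f) := fun _ _ => rfl
  intro a
  refine Submodule.disjoint_def.2 fun x hx hx' => ?_
  have h1 : π a x.1 = x.1 := by
    obtain ⟨f, hf, hfx⟩ := hx
    have hfx : Ideal.Quotient.mk J f = x.1 := hfx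
    rw [← hfx, hπ, IsWeightedHomogeneous.weightedHomogeneousComponent_same hf]
  have h2 : (⨆ c, ⨆ (_ : c ≠ a), rowGrading J b c) ≤
      LinearMap.ker ((π a).comp ((rowModule J b).subtype.restrictScalars K)) := by
    refine iSup₂_le fun c hc y hy => ?_
    obtain ⟨f, hf, hfx⟩ := hy
    have hfx : Ideal.Quotient.mk J f = y.1 := hfx
    change π a y.1 = 0
    rw [← hfx, hπ, IsWeightedHomogeneous.weightedHomogeneousComponent_ne (a, b) hf, map_zero]
    exact fun h => hc (congrArg Prod.fst h).symm
  exact Subtype.ext (h1.symm.trans (h2 hx'))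

end RowGrading

end

noncomputable section

/-! ### The Koszul strand as a minimal resolution of `R_{(*,j)}` -/

section KoszulStrand

variable {n m : ℕ} {K : Type*} [Field K] {J : Ideal (BiPoly n m K)}

lemma mk_splitVariables_symm_mem (J : Ideal (BiPoly n m K)) {j : ℕ} {α : Fin m →₀ ℕ}
    (hα : α.degree = j) :
    Ideal.Quotient.mk J ((splitVariables n m K).symm (monomial α 1)) ∈ biComponent J 0 j := by
  subst hα
  exact ⟨_, isWeightedHomogeneous_splitVariables_symm (isWeightedHomogeneous_one K _) α, rfl⟩

lemma mk_splitVariables_symm_monomial (J : Ideal (BiPoly n m K)) (α : Fin m →₀ ℕ)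
    (p : MvPolynomial (Fin n) K) :
    Ideal.Quotient.mk J ((splitVariables n m K).symm (monomial α p)) =
      p • Ideal.Quotient.mk J ((splitVariables n m K).symm (monomial α 1)) := by
  have h : monomial α p = C p * monomial α (1 : MvPolynomial (Fin n) K) := by
    rw [C_mul_monomial, mul_one]
  rw [h, map_mul, splitVariables_symm_C, ← Algebra.smul_def]
  rfl

/-- The augmentation from a free module onto `R_{(*,j)}`, given by the monomials in `y`. -/
def strandAugmentation (J : Ideal (BiPoly n m K)) (κ : Type*) [Fintype κ] (j : ℕ) :
    (κ × StrandExponent m j 0 → MvPolynomial (Fin n) K) →ₗ[MvPolynomial (Fin n) K]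
      rowModule J (j : ℤ) :=
  Fintype.linearCombination _ fun x =>
    ⟨Ideal.Quotient.mk J ((splitVariables n m K).symm (monomial x.2.1 1)),
      Submodule.mem_iSup_of_mem (p := fun a => biComponent J a j) 0
        (mk_splitVariables_symm_mem J x.2.2)⟩

lemma coe_strandAugmentation {κ : Type*} [Fintype κ] [Unique κ] (j : ℕ)
    (g : κ × StrandExponent m j 0 → MvPolynomial (Fin n) K) :
    (strandAugmentation J κ j g : BiPoly n m K ⧸ J) =
      Ideal.Quotient.mk J ((splitVariables n m K).symm (ofStrand j 0 g default)) := by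
  simp only [strandAugmentation, Fintype.linearCombination_apply, ofStrand, map_sum,
    mk_splitVariables_symm_monomial J _ (g _), AddSubmonoidClass.coe_finsetSum,
    Submodule.coe_smul, Fintype.sum_prod_type, Fintype.sum_unique]

lemma surjective_strandAugmentation (J : Ideal (BiPoly n m K)) (κ : Type*) [Fintype κ] [Unique κ]
    (j : ℕ) : Function.Surjective (strandAugmentation J κ j) := by
  rintro ⟨x, hx⟩
  suffices h : ∃ g, (strandAugmentation J κ j g : BiPoly n m K ⧸ J) = x by
    obtain ⟨g, hg⟩ := h
    exact ⟨g, Subtype.ext hg⟩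
  change x ∈ ⨆ a : ℤ, biComponent J a j at hx
  induction hx using Submodule.iSup_induction' with
  | mem a x hx =>
    obtain ⟨f, hf, rfl⟩ := hx
    refine ⟨toStrand j 0 fun _ => splitVariables n m K f, ?_⟩
    rw [coe_strandAugmentation, ofStrand_toStrand, AlgEquiv.symm_apply_apply]
    · rfl
    · intro _ β hβ
      exact_mod_cast degree_eq_of_coeff_splitVariables hf hβ
  | zero => exact ⟨0, by rw [map_zero]; rfl⟩
  | add x y _ _ hx hy =>
    obtain ⟨g, rfl⟩ := hx
    obtain ⟨h, rfl⟩ := hy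
    exact ⟨g + h, by rw [map_add]; rfl⟩

/-- A sequence of forms in `K[x][y]` that are linear in `y`, homogeneous of positive degrees `a k`
in `x`, form a regular sequence and generate the image of `J`. -/
structure IsLinearRegularSequence (J : Ideal (BiPoly n m K)) (t : ℕ)
    (z : ℕ → MvPolynomial (Fin m) (MvPolynomial (Fin n) K)) (a : ℕ → ℤ) : Prop where
  linear : ∀ k < t, (z k).IsHomogeneous 1
  homogeneous : ∀ k < t, ∀ β,
    IsWeightedHomogeneous (fun _ : Fin n => (1 : ℤ)) (coeff β (z k)) (a k)
  pos : ∀ k < t, 0 < a k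
  mem_iff : ∀ f, f ∈ J ↔ splitVariables n m K f ∈ Ideal.span (z '' Set.Iio t)
  regular : ∀ k < t, ∀ f,
    z k * f ∈ Ideal.span (z '' Set.Iio k) → f ∈ Ideal.span (z '' Set.Iio k)

namespace IsLinearRegularSequence

variable {t : ℕ} {z : ℕ → MvPolynomial (Fin m) (MvPolynomial (Fin n) K)} {a : ℕ → ℤ}

lemma isHomogeneous_koszulMatrix (h : IsLinearRegularSequence J t z a) (i : ℕ)
    (c : koszulIndex t i) (b : koszulIndex t (i + 1)) :
    (koszulMatrix z t i c b).IsHomogeneous 1 :=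
  koszulMatrix_induction z a (P := fun f _ => f.IsHomogeneous 1) (fun _ => isHomogeneous_zero _ _ _)
    (fun _ _ hf => hf.neg) h.linear i c b

lemma isWeightedHomogeneous_coeff_koszulMatrix (h : IsLinearRegularSequence J t z a) (i : ℕ)
    (c : koszulIndex t i) (b : koszulIndex t (i + 1)) (β : Fin m →₀ ℕ) :
    IsWeightedHomogeneous (fun _ : Fin n => (1 : ℤ)) (coeff β (koszulMatrix z t i c b))
      (koszulDeg a t (i + 1) b - koszulDeg a t i c) :=
  koszulMatrix_induction z a
    (P := fun f k => IsWeightedHomogeneous (fun _ : Fin n => (1 : ℤ)) (coeff β f) k)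
    (fun k => by rw [coeff_zero]; exact isWeightedHomogeneous_zero _ _ k)
    (fun f k hf => by rw [coeff_neg]; exact hf.neg) (fun k hk => h.homogeneous k hk β) i c b

/-- Minimality of the strands: the `z k` have positive degree in `x`. -/
lemma constantCoeff_coeff_koszulMatrix (h : IsLinearRegularSequence J t z a) (i : ℕ)
    (c : koszulIndex t i) (b : koszulIndex t (i + 1)) (β : Fin m →₀ ℕ) :
    constantCoeff (coeff β (koszulMatrix z t i c b)) = 0 :=
  koszulMatrix_induction z a (P := fun f _ => constantCoeff (coeff β f) = 0)
    (fun k => by rw [coeff_zero, map_zero])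
    (fun f k hf => by rw [coeff_neg, map_neg, hf, neg_zero])
    (fun k hk => (h.homogeneous k hk β).constantCoeff_eq_zero (h.pos k hk).ne') i c b

/-- The degree `j` strand of the Koszul complex, as a resolution of `R_{(*,j)}`. -/
def resolution (h : IsLinearRegularSequence J t z a) (j : ℕ) :
    GradedFreeResolution n (rowGrading J (j : ℤ)) where
  ι i := koszulIndex t i × StrandExponent m j i
  finite i := inferInstance
  deg i b := koszulDeg a t i b.1
  d i := strandMatrix j i (koszulMatrix z t i)
  ε := strandAugmentation J (koszulIndex t 0) j
  homogeneous_d i c b := by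
    rw [strandMatrix, coeff_mul_monomial']
    split_ifs
    · rw [mul_one]
      exact h.isWeightedHomogeneous_coeff_koszulMatrix i c.1 b.1 _
    · exact isWeightedHomogeneous_zero _ _ _
  homogeneous_ε b := by
    rw [koszulDeg_zero, strandAugmentation, Fintype.linearCombination_apply_single, one_smul]
    exact mk_splitVariables_symm_mem J b.2.2
  surjective_ε := surjective_strandAugmentation J _ j
  exact_zero g := by
    have hg : (fun _ => ofStrand j 0 g default) = ofStrand j 0 g :=
      funext fun x => by rw [Subsingleton.elim x default]
    rw [← Submodule.coe_eq_zero, coe_strandAugmentation, Ideal.Quotient.eq_zero_iff_mem, h.mem_iff,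
      AlgEquiv.apply_symm_apply, mem_span_iff_koszulMatrix, hg,
      ← exists_strandMatrix_mulVec_iff (h.isHomogeneous_koszulMatrix 0)]
    rfl
  exact_succ i g := by
    constructor
    · intro hg
      refine (exists_strandMatrix_mulVec_iff (h.isHomogeneous_koszulMatrix (i + 1)) j (i + 1) g).2
        (koszulMatrix_exact h.regular i ?_)
      rw [← ofStrand_mulVec (h.isHomogeneous_koszulMatrix i)]
      rw [Matrix.mulVecLin_apply] at hg
      rw [hg]
      ext1 b
      simp [ofStrand]
    · rintro ⟨f, rfl⟩
      rw [Matrix.mulVecLin_apply, Matrix.mulVecLin_apply, ← toStrand_ofStrand j _ (Matrix.mulVec _ _),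
        ofStrand_mulVec (h.isHomogeneous_koszulMatrix i),
        ofStrand_mulVec (h.isHomogeneous_koszulMatrix (i + 1)), koszulMatrix_mulVec_mulVec]
      ext1 b
      simp [toStrand]

/-- The row index `j` only decides whether monomials of degree `j - i` in `y` exist; it does not
affect the degrees of the generators. -/
lemma gradedBetti_ne_zero_iff (h : IsLinearRegularSequence J t z a)
    (hind : ∀ b, iSupIndep (rowGrading J b)) (hm : 1 ≤ m) (j i : ℕ) (e : ℤ) :
    gradedBetti n (rowGrading J (j : ℤ)) i e ≠ 0 ↔
      i ≤ j ∧ ∃ b : koszulIndex t i, koszulDeg a t i b = e := by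
  rw [(h.resolution j).gradedBetti_ne_zero_iff_of_minimal (hind _) (smulMem_rowGrading J _)]
  · constructor
    · rintro ⟨⟨b, α, hα⟩, hb⟩
      exact ⟨by omega, b, hb⟩
    · rintro ⟨hij, b, hb⟩
      -- The exponent of the power `y₁^(j - i)`; this is where `m ≥ 1` is needed.
      refine ⟨⟨b, Finsupp.single ⟨0, hm⟩ (j - i), ?_⟩, hb⟩
      rw [Finsupp.degree_single]
      omega
  · intro i c b
    change constantCoeff (coeff c.2.1 (koszulMatrix z t i c.1 b.1 * monomial b.2.1 1)) = 0
    rw [coeff_mul_monomial']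
    split_ifs
    · rw [mul_one]
      exact h.constantCoeff_coeff_koszulMatrix i c.1 b.1 _
    · exact map_zero _

/-- Beyond homological degree `t` the Koszul complex is zero, so for rows from `t` on the bound `i ≤
j` excludes nothing. -/
lemma gradedReg_eq (h : IsLinearRegularSequence J t z a)
    (hind : ∀ b, iSupIndep (rowGrading J b)) (hm : 1 ≤ m) {j k : ℕ} (hj : t ≤ j) (hk : t ≤ k) :
    gradedReg n (rowGrading J (j : ℤ)) = gradedReg n (rowGrading J (k : ℤ)) := by
  have key : ∀ {l : ℕ}, t ≤ l → ∀ i e, gradedBetti n (rowGrading J (l : ℤ)) i e ≠ 0 ↔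
      ∃ b : koszulIndex t i, koszulDeg a t i b = e := fun {l} hl i e => by
    rw [h.gradedBetti_ne_zero_iff hind hm, and_iff_right_iff_imp]
    rintro ⟨b, -⟩
    by_contra hi
    exact (koszulIndex_isEmpty (show t < i by omega)).false b
  simp only [gradedReg, key hj, key hk]

/-- The resolution is linear, and its generators in homological degree `0` show that the value `0`
is attained. -/
lemma gradedReg_eq_zero (h : IsLinearRegularSequence J t z a)
    (hind : ∀ b, iSupIndep (rowGrading J b)) (hm : 1 ≤ m) (ha : ∀ k < t, a k = 1) (j : ℕ) :
    gradedReg n (rowGrading J (j : ℤ)) = 0 := by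
  have hset : {r : WithBot (WithTop ℤ) | ∃ e : ℤ,
      (∃ i : ℕ, gradedBetti n (rowGrading J (j : ℤ)) i (e + i) ≠ 0) ∧
        r = ((e : WithTop ℤ) : WithBot _)} = {0} := by
    ext r
    simp only [h.gradedBetti_ne_zero_iff hind hm, koszulDeg_eq ha, Set.mem_ofPred_eq,
      Set.mem_singleton_iff]
    constructor
    · rintro ⟨e, ⟨i, -, -, hi⟩, rfl⟩
      obtain rfl : e = 0 := by omega
      rfl
    · rintro rfl
      exact ⟨0, ⟨0, Nat.zero_le _, default, by simp⟩, rfl⟩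
  rw [gradedReg, hset, sSup_singleton]

end IsLinearRegularSequence

end KoszulStrand

/-! ### From the regular sequence in `K[x, y]` to the data used over `K[x][y]` -/

section Translation

variable {n m t : ℕ} {K : Type*} [Field K]

/-- Extension of a finite sequence by a constant. -/
def extendSeq {α : Type*} (z : Fin t → α) (x : α) (k : ℕ) : α := if h : k < t then z ⟨k, h⟩ else x

lemma extendSeq_apply {α : Type*} (z : Fin t → α) (x : α) {k : ℕ} (h : k < t) :
    extendSeq z x k = z ⟨k, h⟩ := dif_pos h

lemma mem_span_extendSeq_iff {R S : Type*} [CommRing R] [CommRing S] (e : R ≃+* S) (z : Fin t → R)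
    {k : ℕ} (hk : k ≤ t) (f : R) :
    e f ∈ Ideal.span (extendSeq (fun l => e (z l)) 0 '' Set.Iio k) ↔
      f ∈ Ideal.span (z '' {l | l.1 < k}) := by
  have h : extendSeq (fun l => e (z l)) 0 '' Set.Iio k = e '' (z '' {l | l.1 < k}) := by
    ext x
    constructor
    · rintro ⟨l, hl : l < k, rfl⟩
      exact ⟨_, ⟨⟨l, hl.trans_le hk⟩, hl, rfl⟩, (extendSeq_apply (fun l => e (z l)) 0 (hl.trans_le hk)).symm⟩
    · rintro ⟨_, ⟨l, hl, rfl⟩, rfl⟩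
      exact ⟨l, hl, extendSeq_apply (fun l => e (z l)) 0 l.2⟩
  rw [h, ← Ideal.map_span e, Ideal.mem_map_of_equiv]
  exact ⟨fun ⟨x, hx, hxf⟩ => e.injective hxf ▸ hx, fun hf => ⟨f, hf, rfl⟩⟩

/-- Regularity on the quotient by the first `k` list entries, rewritten as the ideal membership
condition that the Koszul induction consumes. -/
lemma RingTheory.Sequence.IsWeaklyRegular.mem_span_of_mul_mem {R : Type*} [CommRing R]
    {z : Fin t → R} (hz : RingTheory.Sequence.IsWeaklyRegular R (List.ofFn z)) (k : Fin t) {f : R}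
    (hf : z k * f ∈ Ideal.span (z '' {l | l < k})) : f ∈ Ideal.span (z '' {l | l < k}) := by
  have hset : {r | r ∈ (List.ofFn z).take k} = z '' {l | l < k} := by
    ext r
    simp only [Set.mem_ofPred_eq, Set.mem_image, List.mem_take_iff_getElem, List.getElem_ofFn,
      List.length_ofFn]
    constructor
    · rintro ⟨l, hl, rfl⟩
      exact ⟨⟨l, by omega⟩, Fin.lt_def.2 (by simp; omega), rfl⟩
    · rintro ⟨l, hl, rfl⟩
      exact ⟨l, by have := Fin.lt_def.1 hl; omega, rfl⟩
  have h := hz.regular_mod_prev k (by simp)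
  rw [Ideal.ofList, hset, List.getElem_ofFn, Ideal.smul_eq_mul, Ideal.mul_top] at h
  rw [← Ideal.Quotient.eq_zero_iff_mem] at hf ⊢
  exact h (hf.trans (smul_zero _).symm)

lemma isLinearRegularSequence_of_isRegular {J : Ideal (BiPoly n m K)} {z : Fin t → BiPoly n m K}
    {a : Fin t → ℤ} (hJ : J = Ideal.span (Set.range z))
    (hreg : RingTheory.Sequence.IsRegular (BiPoly n m K) (List.ofFn z))
    (hdeg : ∀ k, IsWeightedHomogeneous (bideg n m) (z k) (a k, 1)) (hpos : ∀ k, 0 < a k) :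
    IsLinearRegularSequence J t (extendSeq (fun k => splitVariables n m K (z k)) 0)
      (extendSeq a 0) where
  linear k hk := by
    rw [extendSeq_apply _ _ hk]
    intro β hβ
    have := degree_eq_of_coeff_splitVariables (hdeg ⟨k, hk⟩) hβ
    rw [Finsupp.degree_eq_weight_one] at this
    exact_mod_cast this
  homogeneous k hk β := by
    rw [extendSeq_apply _ _ hk, extendSeq_apply _ _ hk]
    exact isWeightedHomogeneous_coeff_splitVariables (hdeg _) β
  pos k hk := by
    rw [extendSeq_apply _ _ hk]
    exact hpos _
  mem_iff f := by
    have h := mem_span_extendSeq_iff (splitVariables n m K).toRingEquiv z le_rfl f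
    refine Iff.trans ?_ h.symm
    have : {l : Fin t | l.1 < t} = Set.univ := Set.eq_univ_of_forall fun l => l.2
    rw [this, Set.image_univ, hJ]
  regular k hk f hf := by
    have h := mem_span_extendSeq_iff (splitVariables n m K).toRingEquiv z hk.le
    obtain ⟨f, rfl⟩ := (splitVariables n m K).surjective f
    rw [extendSeq_apply _ _ hk, ← map_mul] at hf
    exact (h f).2 (hreg.toIsWeaklyRegular.mem_span_of_mul_mem ⟨k, hk⟩ ((h _).1 hf))

attribute [local instance] MvPolynomial.weightedGradedAlgebra in
lemma iSupIndep_rowGrading_span {z : Fin t → BiPoly n m K} {a : Fin t → ℤ}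
    (hdeg : ∀ k, IsWeightedHomogeneous (bideg n m) (z k) (a k, 1)) (b : ℤ) :
    iSupIndep (rowGrading (Ideal.span (Set.range z)) b) := by
  refine iSupIndep_rowGrading (Ideal.homogeneous_span _ _ ?_) b
  rintro _ ⟨k, rfl⟩
  exact ⟨_, hdeg k⟩

end Translation

end

theorem proposition5p10 {K : Type*} [Field K] [Infinite K] (n m t : ℕ) (hm : 1 ≤ m)
    (J : Ideal (BiPoly n m K)) (z : Fin t → BiPoly n m K) (a : Fin t → ℤ)
    (hJ : J = Ideal.span (Set.range z))
    (hmin : ∀ k, z k ∉ Ideal.span (z '' {k}ᶜ))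
    (hreg : RingTheory.Sequence.IsRegular (BiPoly n m K) (List.ofFn z))
    (hdeg : ∀ k, IsWeightedHomogeneous (bideg n m) (z k) (a k, 1))
    (hmono : Monotone a) (hpos : ∀ k, 0 < a k) :
    (∀ j : ℕ, t ≤ j → gradedReg n (rowGrading J (j + 1)) = gradedReg n (rowGrading J j)) ∧
    ((∀ k, a k = 1) → ∀ j : ℕ, 1 ≤ j → gradedReg n (rowGrading J j) = 0) := by
  have h := isLinearRegularSequence_of_isRegular hJ hreg hdeg hpos
  have hind : ∀ b, iSupIndep (rowGrading J b) := by
    rw [hJ]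
    exact iSupIndep_rowGrading_span hdeg
  refine ⟨fun j hj => ?_, fun ha j _ => h.gradedReg_eq_zero hind hm (fun k hk => ?_) j⟩
  · rw [← h.gradedReg_eq hind hm (hj.trans j.le_succ) hj, Nat.cast_succ]
  · rw [extendSeq_apply _ _ hk, ha]
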